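/- Let $V$ (variables) and $A$ (actions) be sets with $V$ infinite and $|A|\le|V|$, and let $\Sigma$ be a signature of function symbols $f$ with finite arities $ar(f)\in\mathbb N$ and $|\Sigma|\le|V|$. Let $\mathbb T(\Sigma)$ be the set of terms over $\Sigma$ and $V$, and $T(\Sigma)$ the set of closed terms. A (positive or negative) literal is an expression $t\xrightarrow{a}t'$ or $t\not\xrightarrow{a}$ with $t,t'\in\mathbb T(\Sigma)$, $a\in A$; these two deny each other. A transition rule $\frac{H}{\alpha}$ has an arbitrary set $H$ of literals as premises and a literal $\alpha$ as conclusion, whose left-hand side is the source of the rule. A transition system specification (TSS) $P=(\Sigma,R)$ consists of $\Sigma$ and a set $R$ of transition rules over $\Sigma$; it is standard if all its rules have positive conclusions. A rule is an ntytt rule if the right-hand sides of its positive premises are variables that are all distinct and do not occur in the source. It is an ntyxt rule if moreover its source is a variable, and an ntyft rule if moreover its source is $f(x_1,\dots,x_{ar(f)})$ with the $x_i$ distinct variables. It has no lookahead if the variables occurring in right-hand sides of its positive premises do not occur in left-hand sides of its premises. $P$ is in ready simulation format if each of its rules is an ntyft or ntyxt rule without lookahead. Write $P\vdash\frac{K}{\alpha}$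 if there is a well-founded, upwardly branching tree labelled by literals, with root $\alpha$, in which every node is either a leaf marked as hypothesis and labelled in $K$, or is labelled by some $\beta$ such that $\frac{L}{\beta}$, with $L$ the set of labels of the nodes directly above it, is a substitution instance of a rule in $R$. For a closed literal $\alpha$ write $P\vdash_{ws}\alpha$ if there is a well-founded, upwardly branching tree labelled by closed literals with root $\alpha$ such that for every node, with label $\beta$ and with $K$ the set of labels of the nodes directly above it, either $\frac{K}{\beta}$ is a closed substitution instance of a rule in $R$, or $\beta$ is negative and for every set $N$ of negative closed literals such that $P\vdash\frac{N}{\gamma}$ for some closed literal $\gamma$ denying $\beta$, a literal in $K$ denies one in $N$. The ready simulation observations are the formulas generated by $\varphi ::= \top \mid a\varphi \mid \widetilde a \mid \bigwedge_{i\in I}\varphi_i$ ($a\in A$, $I$ an arbitrary index set). For a standard TSS $P$ and $p\in T(\Sigma)$: $p\models_P\top$ always; $p\models_P a\varphi$ iff there is $q\in T(\Sigma)$ with $P\vdash_{ws}p\xrightarrow{a}q$ and $q\models_P\varphi$; $p\models_P\widetilde a$ iff $P\vdash_{ws}p\not\xrightarrow{a}$; $p\models_P\bigwedge_{i\in I}\varphi_i$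 iff $p\models_P\varphi_i$ for all $i\in I$. The ready simulation preorder induced by $P$ is the relation on $T(\Sigma)$ given by $p\sqsubseteq q$ iff every ready simulation observation $\varphi$ with $p\models_P\varphi$ satisfies $q\models_P\varphi$. **Theorem.** If a standard TSS $P$ (not necessarily complete) is in ready simulation format, then the ready simulation preorder $\sqsubseteq$ that it induces is a precongruence: it is a preorder on $T(\Sigma)$ and, for all $f\in\Sigma$ and $p_i,q_i\in T(\Sigma)$, if $p_i\sqsubseteq q_i$ for $i=1,\dots,ar(f)$, then $f(p_1,\dots,p_{ar(f)})\sqsubseteq f(q_1,\dots,q_{ar(f)})$. -/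

import Mathlib

universe uV uF uA w

namespace SOS

/-- A signature: a type of function symbols, each with a finite arity. -/
structure Signature where
  Fn : Type uF
  ar : Fn → ℕ

/-- Open terms over the signature `S` with variables in `V`. -/
inductive Term (S : Signature.{uF}) (V : Type uV) : Type (max uF uV)
  | var (x : V) : Term S V
  | app (f : S.Fn) (ts : Fin (S.ar f) → Term S V) : Term S V

namespace Term

/-- The set of variables occurring in a term. -/
def vars {S : Signature.{uF}} {V : Type uV} : Term S V → Set V
  | var x => {x}
  | app _ ts => ⋃ i, vars (ts i)

/-- Simultaneous substitution. Partial substitutions are total ones that are the identity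
outside their domain. -/
def subst {S : Signature.{uF}} {V : Type uV} (σ : V → Term S V) : Term S V → Term S V
  | var x => σ x
  | app f ts => app f fun i => subst σ (ts i)

theorem vars_subst_eq_empty {S : Signature.{uF}} {V : Type uV} (σ : V → Term S V)
    (hσ : ∀ x, (σ x).vars = ∅) (t : Term S V) : (t.subst σ).vars = ∅ := by
  induction t with
  | var x => exact hσ x
  | app f ts ih => simpa [subst, vars] using ih

end Term

/-- Closed terms: terms without variables. -/
abbrev ClosedTerm (S : Signature.{uF}) (V : Type uV) : Type (max uF uV) :=
  {t : Term S V // t.vars = ∅}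

/-- The closed term `f(p₁, …, pₙ)`. -/
def ClosedTerm.app {S : Signature.{uF}} {V : Type uV} (f : S.Fn)
    (ps : Fin (S.ar f) → ClosedTerm S V) : ClosedTerm S V :=
  ⟨Term.app f fun i => (ps i).1, by simp [Term.vars, (ps _).2]⟩

/-- The closed term obtained from a term by a closed substitution. -/
def Term.close {S : Signature.{uF}} {V : Type uV} (σ : V → ClosedTerm S V) (t : Term S V) :
    ClosedTerm S V :=
  ⟨t.subst fun x => (σ x).1, Term.vars_subst_eq_empty _ (fun x => (σ x).2) t⟩

/-- Literals over a type `T` of terms: `pos t a u` is `t —a→ u`, `neg t a` is `t —a↛`. -/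
inductive Literal (T : Type w) (A : Type uA) : Type (max w uA)
  | pos (t : T) (a : A) (u : T) : Literal T A
  | neg (t : T) (a : A) : Literal T A

namespace Literal

/-- Apply a function to every term of a literal. -/
def map {T : Type*} {T' : Type*} {A : Type*} (g : T → T') : Literal T A → Literal T' A
  | pos t a u => pos (g t) a (g u)
  | neg t a => neg (g t) a

/-- The left-hand side of a literal. -/
def lhs {T : Type*} {A : Type*} : Literal T A → T
  | pos t _ _ => t
  | neg t _ => t

/-- Negative literals. -/
def IsNeg {T : Type*} {A : Type*} (l : Literal T A) : Prop := ∃ t a, l = neg t a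

/-- Two literals deny each other if they are of the form `t —a→ u` and `t —a↛`, in either order. -/
def Denies {T : Type*} {A : Type*} (l m : Literal T A) : Prop :=
  ∃ t a u, (l = pos t a u ∧ m = neg t a) ∨ (l = neg t a ∧ m = pos t a u)

end Literal

/-- A transition rule: an arbitrary set of premises and a conclusion. -/
structure Rule (S : Signature.{uF}) (V : Type uV) (A : Type uA) where
  prems : Set (Literal (Term S V) A)
  concl : Literal (Term S V) A

namespace Rule

/-- The source of a rule. -/
def source {S : Signature.{uF}} {V : Type uV} {A : Type uA} (r : Rule S V A) : Term S V :=
  r.concl.lhs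

/-- `ntytt` rules: right-hand sides of positive premises are variables, distinct for distinct
premises, that do not occur in the source. -/
def IsNtytt {S : Signature.{uF}} {V : Type uV} {A : Type uA} (r : Rule S V A) : Prop :=
  (∀ t a u, Literal.pos t a u ∈ r.prems → ∃ y, u = Term.var y ∧ y ∉ r.source.vars) ∧
  (∀ t a u t' a' u', Literal.pos t a u ∈ r.prems → Literal.pos t' a' u' ∈ r.prems →
    u = u' → t = t' ∧ a = a')

/-- `ntyxt` rules: `ntytt` rules whose source is a variable. -/
def IsNtyxt {S : Signature.{uF}} {V : Type uV} {A : Type uA} (r : Rule S V A) : Prop :=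
  r.IsNtytt ∧ ∃ x, r.source = Term.var x

/-- `ntyft` rules: `ntytt` rules whose source is `f(x₁, …, xₙ)` with the `xᵢ` distinct. -/
def IsNtyft {S : Signature.{uF}} {V : Type uV} {A : Type uA} (r : Rule S V A) : Prop :=
  r.IsNtytt ∧ ∃ (f : S.Fn) (x : Fin (S.ar f) → V),
    Function.Injective x ∧ r.source = Term.app f fun i => Term.var (x i)

/-- No lookahead: variables of right-hand sides of positive premises do not occur in left-hand
sides of (positive or negative) premises. -/
def NoLookahead {S : Signature.{uF}} {V : Type uV} {A : Type uA} (r : Rule S V A) : Prop :=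
  ∀ t a u, Literal.pos t a u ∈ r.prems → ∀ y ∈ u.vars, ∀ l ∈ r.prems, y ∉ l.lhs.vars

end Rule

/-- A transition system specification over `S`, with variables `V` and actions `A`. -/
structure TSS (S : Signature.{uF}) (V : Type uV) (A : Type uA) where
  rules : Set (Rule S V A)

namespace TSS

/-- A TSS is standard if all its rules have positive conclusions. -/
def IsStandard {S : Signature.{uF}} {V : Type uV} {A : Type uA} (P : TSS S V A) : Prop :=
  ∀ r ∈ P.rules, ¬ r.concl.IsNeg

/-- Ready simulation format: `ntyft/ntyxt` format without lookahead. -/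
def IsReadySimulationFormat {S : Signature.{uF}} {V : Type uV} {A : Type uA}
    (P : TSS S V A) : Prop :=
  ∀ r ∈ P.rules, (r.IsNtyft ∨ r.IsNtyxt) ∧ r.NoLookahead

/-- `P.Proves K α`: the rule `K / α` is provable from `P`, that is, `α` is the root of a
well-founded proof tree whose hypotheses all lie in `K`. Labels may be open literals. -/
inductive Proves {S : Signature.{uF}} {V : Type uV} {A : Type uA} (P : TSS S V A)
    (K : Set (Literal (Term S V) A)) : Literal (Term S V) A → Prop
  | hyp (α : Literal (Term S V) A) (hα : α ∈ K) : Proves P K α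
  | rule (r : Rule S V A) (hr : r ∈ P.rules) (σ : V → Term S V)
      (h : ∀ l ∈ r.prems, Proves P K (l.map (Term.subst σ))) :
      Proves P K (r.concl.map (Term.subst σ))

/-- `P.WSProves α`: the closed literal `α` has a well-supported proof from `P`. The constructor
`naf` is negation as failure: `K` is the set of literals directly above a negative literal `β`. -/
inductive WSProves {S : Signature.{uF}} {V : Type uV} {A : Type uA} (P : TSS S V A) :
    Literal (ClosedTerm S V) A → Prop
  | rule (r : Rule S V A) (hr : r ∈ P.rules) (σ : V → ClosedTerm S V)
      (h : ∀ l ∈ r.prems, WSProves P (l.map (Term.close σ))) :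
      WSProves P (r.concl.map (Term.close σ))
  | naf (β : Literal (ClosedTerm S V) A) (hβ : β.IsNeg) (K : Set (Literal (ClosedTerm S V) A))
      (hK : ∀ l ∈ K, WSProves P l)
      (h : ∀ (N : Set (Literal (ClosedTerm S V) A)) (γ : Literal (ClosedTerm S V) A),
        (∀ l ∈ N, l.IsNeg) → γ.Denies β →
        P.Proves (Literal.map Subtype.val '' N) (γ.map Subtype.val) →
        ∃ k ∈ K, ∃ l ∈ N, k.Denies l) :
      WSProves P β

end TSS

/-- Ready simulation observations over `A`, with conjunctions indexed by arbitrary types of a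
given universe. -/
inductive RSObs (A : Type uA) : Type (max uA (w + 1))
  | top : RSObs A
  | dia (a : A) (φ : RSObs A) : RSObs A
  | refuse (a : A) : RSObs A
  | conj (I : Type w) (φ : I → RSObs A) : RSObs A

namespace TSS

/-- The satisfaction relation `p ⊨_P φ` between closed terms and ready simulation observations. -/
def Sat {S : Signature.{uF}} {V : Type uV} {A : Type uA} (P : TSS S V A) :
    RSObs.{uA, w} A → ClosedTerm S V → Prop
  | RSObs.top, _ => True
  | RSObs.dia a φ, p => ∃ q, P.WSProves (Literal.pos p a q) ∧ Sat P φ q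
  | RSObs.refuse a, p => P.WSProves (Literal.neg p a)
  | RSObs.conj _ φ, p => ∀ i, Sat P (φ i) p

/-- The ready simulation preorder induced by `P`: inclusion of sets of ready simulation
observations. The index types of conjunctions range over a universe that contains copies of the
types of variables, function symbols, actions and closed terms. -/
def ReadySimPreorder {S : Signature.{uF}} {V : Type uV} {A : Type uA} (P : TSS S V A)
    (p q : ClosedTerm S V) : Prop :=
  ∀ φ : RSObs.{uA, max uV uF uA} A, P.Sat φ p → P.Sat φ q

end TSS

/-- A precongruence on closed terms: a preorder compatible with all function symbols. -/
def IsPrecongruence {S : Signature.{uF}} {V : Type uV}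
    (R : ClosedTerm S V → ClosedTerm S V → Prop) : Prop :=
  (∀ p, R p p) ∧ (∀ p q r, R p q → R q r → R p r) ∧
  ∀ (f : S.Fn) (ps qs : Fin (S.ar f) → ClosedTerm S V),
    (∀ i, R (ps i) (qs i)) → R (ClosedTerm.app f ps) (ClosedTerm.app f qs)

end SOS

namespace SOS

variable {S : Signature.{uF}} {V : Type uV} {A : Type uA}

namespace Term

/-! The preorder is the largest ready simulation: it is one because conjunctions range over all
closed terms, and it contains every other. So it suffices that the congruence closure of a reflexive
ready simulation `B` is again one (`IsReadySimulation.congrClosure`). This goes by induction on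
well-supported proofs (`WSProves.lifts`). A rule application moves to a larger term by lifting the
premises and choosing new targets; absence of lookahead keeps this choice from disturbing other
premises (`lifts_concl`). For a refusal, a potential transition of the larger term is carried
backwards to the smaller one, under the converse of `B` and with targets forgotten
(`lifts_of_closedProves_undenied`), against the support of the given refusal. -/

theorem subst_congr {σ τ : V → Term S V} (t : Term S V) (h : ∀ x ∈ t.vars, σ x = τ x) :
    t.subst σ = t.subst τ := by
  induction t with
  | var x => exact h x rfl
  | app f ts ih =>
    simp only [subst, app.injEq, heq_eq_eq, true_and]
    funext i
    exact ih i fun x hx => h x (Set.mem_iUnion.2 ⟨i, hx⟩)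

theorem subst_var (t : Term S V) : t.subst var = t := by
  induction t with
  | var x => rfl
  | app f ts ih => simp [subst, ih]

theorem subst_subst (σ τ : V → Term S V) (t : Term S V) :
    (t.subst σ).subst τ = t.subst fun x => (σ x).subst τ := by
  induction t with
  | var x => rfl
  | app f ts ih => simp [subst, ih]

theorem close_congr {σ τ : V → ClosedTerm S V} (t : Term S V) (h : ∀ x ∈ t.vars, σ x = τ x) :
    t.close σ = t.close τ :=
  Subtype.ext (subst_congr t fun x hx => congrArg Subtype.val (h x hx))

theorem close_val (σ : V → ClosedTerm S V) (p : ClosedTerm S V) : p.1.close σ = p := by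
  refine Subtype.ext ((subst_congr p.1 fun x hx => ?_).trans (subst_var p.1))
  simp [p.2] at hx

theorem close_subst (σ : V → Term S V) (τ : V → ClosedTerm S V) (t : Term S V) :
    (t.subst σ).close τ = t.close fun x => (σ x).close τ :=
  Subtype.ext (subst_subst _ _ t)

end Term

theorem Literal.map_map {T T' T'' : Type*} (g : T → T') (h : T' → T'') (l : Literal T A) :
    (l.map g).map h = l.map fun t => h (g t) := by
  cases l <;> rfl

theorem Literal.map_id' {T : Type*} (l : Literal T A) : (l.map fun t => t) = l := by
  cases l <;> rfl

/-! ### Congruence closure and sources of rules -/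

/-- The closure of a relation on closed terms under all function symbols. -/
inductive CongrClosure (B : ClosedTerm S V → ClosedTerm S V → Prop) :
    ClosedTerm S V → ClosedTerm S V → Prop
  | base {p q : ClosedTerm S V} (h : B p q) : CongrClosure B p q
  | app (f : S.Fn) (ps qs : Fin (S.ar f) → ClosedTerm S V)
      (h : ∀ i, CongrClosure B (ps i) (qs i)) :
      CongrClosure B (ClosedTerm.app f ps) (ClosedTerm.app f qs)

namespace CongrClosure

variable {B : ClosedTerm S V → ClosedTerm S V → Prop}

theorem swap {p q : ClosedTerm S V} (h : CongrClosure B p q) :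
    CongrClosure (fun x y => B y x) q p := by
  induction h with
  | base h => exact .base h
  | app f ps qs _ ih => exact .app f qs ps ih

theorem close {σ τ : V → ClosedTerm S V} (h : ∀ x, CongrClosure B (σ x) (τ x)) (t : Term S V) :
    CongrClosure B (t.close σ) (t.close τ) := by
  induction t with
  | var x => exact h x
  | app f ts ih => exact .app f (fun i => (ts i).close σ) (fun i => (ts i).close τ) ih

/-- A term related to an instance of the source of a rule is an instance of that source. -/
theorem exists_close_source (hB : ∀ p, B p p) {r : Rule S V A} (hr : r.IsNtyft ∨ r.IsNtyxt)
    (σ : V → ClosedTerm S V) {p q : ClosedTerm S V} (h : CongrClosure B p q)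
    (hp : r.source.close σ = p) :
    B p q ∨ ∃ τ : V → ClosedTerm S V,
      (∀ x, CongrClosure B (σ x) (τ x)) ∧ r.source.close τ = q := by
  classical
  rcases hr with ⟨-, f, x, hx, hs⟩ | ⟨-, x, hs⟩
  · cases h with
    | base h => exact .inl h
    | app g ps qs h =>
      right
      have hp' := congrArg Subtype.val hp
      simp only [hs, Term.close, Term.subst, ClosedTerm.app, Term.app.injEq] at hp'
      obtain ⟨rfl, hp'⟩ := hp'
      have hσ : ∀ i, σ (x i) = ps i := fun i => Subtype.ext (congrFun (eq_of_heq hp') i)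
      -- Only the source variables change; elsewhere reflexivity of `B` suffices. Injectivity of `x`
      -- makes the chosen index the right one.
      refine ⟨fun z => if hz : ∃ i, x i = z then qs hz.choose else σ z, fun z => ?_, ?_⟩
      · by_cases hz : ∃ i, x i = z
        · have := h hz.choose
          rw [← hσ, hz.choose_spec] at this
          simpa only [hz, dif_pos] using this
        · simpa only [hz, dif_neg, not_false_eq_true] using CongrClosure.base (hB _)
      · refine Subtype.ext ?_
        simp only [hs, Term.close, Term.subst, ClosedTerm.app, Term.app.injEq, heq_eq_eq, true_and]
        funext i
        have hz : ∃ j, x j = x i := ⟨i, rfl⟩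
        rw [dif_pos hz, hx hz.choose_spec]
  · right
    refine ⟨fun z => if z = x then q else σ z, fun z => ?_, ?_⟩
    · by_cases hz : z = x
      · subst hz
        have : σ z = p := by rw [← hp, hs]; rfl
        simpa [this] using h
      · simpa [hz] using CongrClosure.base (hB _)
    · rw [hs]
      exact Subtype.ext (by simp [Term.close, Term.subst])

end CongrClosure

/-! ### Lifting through a rule -/

/-- `l.Lifts D E G`: whenever the left-hand side of `l` is `D`-related to `q`, some literal in `G`
of the same kind as `l` has left-hand side `q` (and an `E`-related right-hand side). -/
def Literal.Lifts {T : Type*} (D E : T → T → Prop) (G : Literal T A → Prop) : Literal T A → Prop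
  | pos p a p' => ∀ q, D p q → ∃ q', G (pos q a q') ∧ E p' q'
  | neg p a => ∀ q, D p q → G (neg q a)

/-- Absence of lookahead lets the conclusion of a rule be lifted once all premises can. -/
theorem lifts_concl {B E : ClosedTerm S V → ClosedTerm S V → Prop}
    {G : Literal (ClosedTerm S V) A → Prop} (hB : ∀ p, B p p)
    (hBE : ∀ p q, CongrClosure B p q → E p q) {r : Rule S V A}
    (hfmt : (r.IsNtyft ∨ r.IsNtyxt) ∧ r.NoLookahead) (hpos : ¬ r.concl.IsNeg)
    (σ : V → ClosedTerm S V)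
    (hE : ∀ τ : V → ClosedTerm S V, (∀ x, E (σ x) (τ x)) → ∀ t : Term S V,
      E (t.close σ) (t.close τ))
    (hG : ∀ τ : V → ClosedTerm S V, (∀ l ∈ r.prems, G (l.map (Term.close τ))) →
      G (r.concl.map (Term.close τ)))
    (hbase : ∀ p a p' q, r.concl.map (Term.close σ) = .pos p a p' → B p q →
      ∃ q', G (.pos q a q') ∧ E p' q')
    (h : ∀ l ∈ r.prems, (l.map (Term.close σ)).Lifts (CongrClosure B) E G) :
    (r.concl.map (Term.close σ)).Lifts (CongrClosure B) E G := by
  classical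
  obtain ⟨hsrc, hla⟩ := hfmt
  have hnt : r.IsNtytt := hsrc.elim And.left And.left
  obtain ⟨s, a, u, hc⟩ : ∃ s a u, r.concl = .pos s a u := by
    cases hc : r.concl with
    | pos s a u => exact ⟨s, a, u, rfl⟩
    | neg s a => exact absurd ⟨s, a, hc⟩ hpos
  have hs : r.source = s := by rw [Rule.source, hc]; rfl
  rw [hc]
  intro q hq
  rcases hq.exists_close_source hB hsrc σ (by rw [hs]) with hb | ⟨τ, hτ, hτq⟩
  · exact hbase _ _ _ _ (by rw [hc]; rfl) hb
  -- Alter `τ` only at targets of positive premises, taking there the target that lifting supplies.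
  -- Each such variable belongs to a single premise, so the choice is consistent.
  have key : ∀ y, ∃ v, E (σ y) v ∧
      (∀ t c, .pos t c (.var y) ∈ r.prems → G (.pos (t.close τ) c v)) ∧
      ((¬ ∃ t c, .pos t c (.var y) ∈ r.prems) → v = τ y) := by
    intro y
    by_cases hy : ∃ t c, .pos t c (.var y) ∈ r.prems
    · obtain ⟨t, c, hm⟩ := hy
      obtain ⟨v, hv, hEv⟩ := h _ hm _ (CongrClosure.close hτ t)
      refine ⟨v, hEv, fun t' c' hm' => ?_, fun hn => absurd ⟨t, c, hm⟩ hn⟩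
      obtain ⟨rfl, rfl⟩ := hnt.2 _ _ _ _ _ _ hm hm' rfl
      exact hv
    · exact ⟨τ y, hBE _ _ (hτ y), fun t c hm => absurd ⟨t, c, hm⟩ hy, fun _ => rfl⟩
  choose ρ hρE hρG hρ using key
  have hlhs : ∀ l ∈ r.prems, l.lhs.close ρ = l.lhs.close τ := fun l hl =>
    Term.close_congr _ fun x hx => hρ x fun ⟨t, c, hm⟩ => hla _ _ _ hm x rfl l hl hx
  have hsource : s.close ρ = q := by
    rw [← hτq, hs]
    refine Term.close_congr _ fun x hx => hρ x fun ⟨t, c, hm⟩ => ?_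
    obtain ⟨y, hy, hys⟩ := hnt.1 _ _ _ hm
    cases hy
    exact hys (hs ▸ hx)
  refine ⟨u.close ρ, ?_, hE ρ hρE u⟩
  have hGc := hG ρ fun l hl => ?_
  · rw [hc] at hGc
    simpa only [Literal.map, hsource] using hGc
  · have hl' := hlhs l hl
    cases l with
    | pos t c w =>
      obtain ⟨y, rfl, -⟩ := hnt.1 _ _ _ hl
      simp only [Literal.lhs] at hl'
      simp only [Literal.map, hl']
      exact hρG y t c hl
    | neg t c =>
      simp only [Literal.lhs] at hl'
      simp only [Literal.map, hl']
      exact h _ hl _ (CongrClosure.close hτ t)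

namespace TSS

variable {P : TSS S V A}

/-! ### Closed proofs and negation as failure -/

/-- Provability of closed literals from closed hypotheses by closed instances of rules. -/
inductive ClosedProves (P : TSS S V A) (N : Set (Literal (ClosedTerm S V) A)) :
    Literal (ClosedTerm S V) A → Prop
  | hyp (α : Literal (ClosedTerm S V) A) (hα : α ∈ N) : ClosedProves P N α
  | rule (r : Rule S V A) (hr : r ∈ P.rules) (σ : V → ClosedTerm S V)
      (h : ∀ l ∈ r.prems, ClosedProves P N (l.map (Term.close σ))) :
      ClosedProves P N (r.concl.map (Term.close σ))

theorem ClosedProves.mono {N M : Set (Literal (ClosedTerm S V) A)} (hNM : N ⊆ M)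
    {α : Literal (ClosedTerm S V) A} (h : P.ClosedProves N α) : P.ClosedProves M α := by
  induction h with
  | hyp α hα => exact .hyp α (hNM hα)
  | rule r hr σ _ ih => exact .rule r hr σ ih

theorem ClosedProves.proves {N : Set (Literal (ClosedTerm S V) A)}
    {α : Literal (ClosedTerm S V) A} (h : P.ClosedProves N α) :
    P.Proves (Literal.map Subtype.val '' N) (α.map Subtype.val) := by
  induction h with
  | hyp α hα => exact .hyp _ ⟨α, hα, rfl⟩
  | rule r hr σ _ ih =>
    simp only [Literal.map_map] at ih ⊢
    exact .rule r hr (fun x => (σ x).1) ih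

/-- Open terms inside a proof are harmless: applying `τ` throughout closes them and fixes the closed
hypotheses. -/
theorem Proves.closedProves_map {N : Set (Literal (ClosedTerm S V) A)}
    {α : Literal (Term S V) A} (h : P.Proves (Literal.map Subtype.val '' N) α)
    (τ : V → ClosedTerm S V) : P.ClosedProves N (α.map (Term.close τ)) := by
  induction h with
  | hyp α hα =>
    obtain ⟨β, hβ, rfl⟩ := hα
    simp only [Literal.map_map, Term.close_val, Literal.map_id']
    exact .hyp β hβ
  | rule r hr σ _ ih =>
    simp only [Literal.map_map, Term.close_subst] at ih ⊢
    exact .rule r hr _ ih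

theorem closedProves_iff {N : Set (Literal (ClosedTerm S V) A)} {p q : ClosedTerm S V} {a : A} :
    P.Proves (Literal.map Subtype.val '' N) ((Literal.pos p a q).map Subtype.val) ↔
      P.ClosedProves N (.pos p a q) := by
  refine ⟨fun h => ?_, ClosedProves.proves⟩
  -- Any closed substitution will do; `p` witnesses that a closed term exists.
  have := h.closedProves_map fun _ => p
  simpa only [Literal.map_map, Term.close_val, Literal.map_id'] using this

/-- The negative literals not denied by any literal in `K`. -/
def undenied (K : Set (Literal (ClosedTerm S V) A)) : Set (Literal (ClosedTerm S V) A) :=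
  {l | l.IsNeg ∧ ∀ k ∈ K, ¬ k.Denies l}

theorem neg_mem_undenied {K : Set (Literal (ClosedTerm S V) A)} {p : ClosedTerm S V} {a : A} :
    .neg p a ∈ undenied K ↔ ∀ q, .pos p a q ∉ K := by
  constructor
  · exact fun h q hq => h.2 _ hq ⟨p, a, q, .inl ⟨rfl, rfl⟩⟩
  · refine fun h => ⟨⟨p, a, rfl⟩, fun k hk ⟨t, b, u, hd⟩ => ?_⟩
    rcases hd with ⟨rfl, hd⟩ | ⟨-, hd⟩
    · cases hd
      exact h u hk
    · cases hd

/-- `undenied K` is the largest set of negative literals that `K` fails to deny, so by monotonicity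
it is the only `N` to test. -/
theorem denied_iff_not_closedProves_undenied {K : Set (Literal (ClosedTerm S V) A)}
    {p : ClosedTerm S V} {a : A} :
    (∀ (N : Set (Literal (ClosedTerm S V) A)) (γ : Literal (ClosedTerm S V) A),
        (∀ l ∈ N, l.IsNeg) → γ.Denies (.neg p a) →
        P.Proves (Literal.map Subtype.val '' N) (γ.map Subtype.val) →
        ∃ k ∈ K, ∃ l ∈ N, k.Denies l) ↔
      ∀ q, ¬ P.ClosedProves (undenied K) (.pos p a q) := by
  constructor
  · intro h q hq
    obtain ⟨k, hk, l, hl, hd⟩ := h (undenied K) (.pos p a q) (fun l hl => hl.1)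
      ⟨p, a, q, .inl ⟨rfl, rfl⟩⟩ hq.proves
    exact hl.2 k hk hd
  · rintro h N γ hN ⟨t, b, u, hd⟩ hγ
    rcases hd with ⟨rfl, hd⟩ | ⟨-, hd⟩
    · cases hd
      by_contra! hc
      exact h u ((closedProves_iff.1 hγ).mono fun l hl =>
        And.intro (hN l hl) fun k hk => hc k hk l hl)
    · cases hd

theorem wsProves_neg {K : Set (Literal (ClosedTerm S V) A)} (hK : ∀ l ∈ K, P.WSProves l)
    {p : ClosedTerm S V} {a : A} (h : ∀ q, ¬ P.ClosedProves (undenied K) (.pos p a q)) :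
    P.WSProves (.neg p a) :=
  .naf _ ⟨p, a, rfl⟩ K hK (denied_iff_not_closedProves_undenied.2 h)

/-- In a standard TSS a negative literal can only come from `naf`. Its `K` consists of
well-supported literals, and enlarging `K` to all of them shrinks `undenied`. -/
theorem WSProves.not_closedProves_undenied (hstd : P.IsStandard) {p : ClosedTerm S V} {a : A}
    (h : P.WSProves (.neg p a)) (q : ClosedTerm S V) :
    ¬ P.ClosedProves (undenied {l | P.WSProves l}) (.pos p a q) := by
  generalize hl : Literal.neg p a = l at h
  cases h with
  | rule r hr σ _ =>
    refine absurd ?_ (hstd r hr)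
    cases hc : r.concl with
    | pos t b u => rw [hc] at hl; cases hl
    | neg t b => exact ⟨t, b, rfl⟩
  | naf β _ K hK h =>
    subst hl
    refine fun hq => denied_iff_not_closedProves_undenied.1 h q (hq.mono fun l hl => ?_)
    exact ⟨hl.1, fun k hk => hl.2 k (hK k hk)⟩

/-! ### Ready simulations and the preorder -/

/-- Ready simulations between closed terms, relative to well-supported provability. -/
structure IsReadySimulation (P : TSS S V A) (B : ClosedTerm S V → ClosedTerm S V → Prop) :
    Prop where
  step : ∀ {p q a p'}, B p q → P.WSProves (.pos p a p') → ∃ q', P.WSProves (.pos q a q') ∧ B p' q'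
  refuse : ∀ {p q a}, B p q → P.WSProves (.neg p a) → P.WSProves (.neg q a)

theorem IsReadySimulation.readySimPreorder {B : ClosedTerm S V → ClosedTerm S V → Prop}
    (h : P.IsReadySimulation B) {p q : ClosedTerm S V} (hpq : B p q) :
    P.ReadySimPreorder p q := by
  intro φ
  induction φ generalizing p q with
  | top => exact fun _ => trivial
  | dia a φ ih =>
    rintro ⟨p', hp', hφ⟩
    obtain ⟨q', hq', hB⟩ := h.step hpq hp'
    exact ⟨q', hq', ih hB hφ⟩
  | refuse a => exact h.refuse hpq
  | conj I φ ih => exact fun hp i => ih i hpq (hp i)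

/-- If no `a`-successor of `q` were above `p'`, the conjunction of separating formulas, prefixed by
`a`, would hold at `p` but not at `q`. -/
theorem isReadySimulation_readySimPreorder (P : TSS S V A) :
    P.IsReadySimulation P.ReadySimPreorder where
  step {p q a p'} hpq hp' := by
    by_contra! hc
    have hsep : ∀ q' : ClosedTerm S V, ∃ φ : RSObs.{uA, max uV uF uA} A,
        P.Sat φ p' ∧ (P.WSProves (.pos q a q') → ¬ P.Sat φ q') := by
      intro q'
      by_cases hq' : P.WSProves (.pos q a q')
      · have := hc q' hq'
        simp only [ReadySimPreorder, not_forall] at this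
        obtain ⟨φ, h1, h2⟩ := this
        exact ⟨φ, h1, fun _ => h2⟩
      · exact ⟨.top, trivial, fun h => absurd h hq'⟩
    choose φ hφ hφq using hsep
    obtain ⟨q', hq', hs⟩ := hpq
      (.dia a (.conj (ULift.{max uV uF uA} (ClosedTerm S V)) fun i => φ i.down))
      ⟨p', hp', fun i => hφ i.down⟩
    exact hφq q' hq' (hs ⟨q'⟩)
  refuse {_ _ a} hpq := hpq (.refuse a)

/-! ### Closure of ready simulations under contexts -/

/-- If `q` can do an action assuming all negative literals not denied by well-supported proofs,
then a term below `q` can do it assuming those not denied by a set `K` of lifting literals. -/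
theorem lifts_of_closedProves_undenied (hstd : P.IsStandard) (hfmt : P.IsReadySimulationFormat)
    {B : ClosedTerm S V → ClosedTerm S V → Prop} (hB : P.IsReadySimulation B)
    (hrefl : ∀ p, B p p) {K : Set (Literal (ClosedTerm S V) A)} (hK : ∀ l ∈ K, P.WSProves l)
    (hlift : ∀ l ∈ K, l.Lifts (CongrClosure B) (CongrClosure B) P.WSProves)
    {l : Literal (ClosedTerm S V) A}
    (h : P.ClosedProves (undenied {l | P.WSProves l}) l) :
    l.Lifts (CongrClosure fun x y => B y x) (fun _ _ => True) (P.ClosedProves (undenied K)) := by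
  induction h with
  | hyp α hα =>
    obtain ⟨q, a, rfl⟩ := hα.1
    -- If `K` denied this leaf at `p`, lifting the denying transition would deny the original leaf
    -- at `q`.
    refine fun p hp => .hyp _ (neg_mem_undenied.2 fun s hs => ?_)
    obtain ⟨s', hs', -⟩ := hlift _ hs q hp.swap
    exact neg_mem_undenied.1 hα s' hs'
  | rule r hr σ h ih =>
    refine lifts_concl (B := fun x y => B y x) (G := P.ClosedProves (undenied K)) hrefl
      (fun _ _ _ => trivial) (hfmt r hr) (hstd r hr) σ
      (fun _ _ _ => trivial) (ClosedProves.rule r hr) ?_ ih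
    intro q a u p hc hpq
    by_contra! hn
    -- With no such transition, `K` supports a refusal at `p`; `B` passes it on to `q`, excluding
    -- the transition of `q` just proved.
    have hp : P.WSProves (.neg p a) := wsProves_neg hK fun v hv => hn v hv
    refine (hB.refuse hpq hp).not_closedProves_undenied hstd u ?_
    rw [← hc]
    exact .rule r hr σ h

theorem WSProves.lifts (hstd : P.IsStandard) (hfmt : P.IsReadySimulationFormat)
    {B : ClosedTerm S V → ClosedTerm S V → Prop} (hB : P.IsReadySimulation B)
    (hrefl : ∀ p, B p p) {l : Literal (ClosedTerm S V) A} (h : P.WSProves l) :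
    l.Lifts (CongrClosure B) (CongrClosure B) P.WSProves := by
  induction h with
  | rule r hr σ h ih =>
    refine lifts_concl hrefl (fun _ _ => id) (hfmt r hr) (hstd r hr) σ
      (fun _ => CongrClosure.close) (fun τ => .rule r hr τ) ?_ ih
    intro p a p' q hc hpq
    obtain ⟨q', hq', hb⟩ := hB.step (a := a) (p' := p') hpq (hc ▸ .rule r hr σ h)
    exact ⟨q', hq', .base hb⟩
  | naf β hβ K hK h ih =>
    obtain ⟨p, a, rfl⟩ := hβ
    intro q hpq
    -- All well-supported literals are put above the new node, as this denies the most.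
    refine wsProves_neg (K := {l | P.WSProves l}) (fun _ => id) fun u hu => ?_
    obtain ⟨v, hv, -⟩ := lifts_of_closedProves_undenied hstd hfmt hB hrefl hK ih hu p hpq.swap
    exact denied_iff_not_closedProves_undenied.1 h v hv

theorem IsReadySimulation.congrClosure (hstd : P.IsStandard) (hfmt : P.IsReadySimulationFormat)
    {B : ClosedTerm S V → ClosedTerm S V → Prop} (hB : P.IsReadySimulation B)
    (hrefl : ∀ p, B p p) : P.IsReadySimulation (CongrClosure B) where
  step hpq h := h.lifts hstd hfmt hB hrefl _ hpq
  refuse hpq h := h.lifts hstd hfmt hB hrefl _ hpq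

end TSS

end SOS

theorem mainTheorem4 {V : Type uV} {A : Type uA} {S : SOS.Signature.{uF}}
    (hV : Infinite V) (hA : Nonempty (A ↪ V)) (hS : Nonempty (S.Fn ↪ V))
    (P : SOS.TSS S V A) (hstd : P.IsStandard) (hfmt : P.IsReadySimulationFormat) :
    SOS.IsPrecongruence P.ReadySimPreorder := by
  have hrefl : ∀ p, P.ReadySimPreorder p p := fun _ _ => id
  refine ⟨hrefl, fun p q r hpq hqr φ hp => hqr φ (hpq φ hp), fun f ps qs h => ?_⟩
  exact (P.isReadySimulation_readySimPreorder.congrClosure hstd hfmt hrefl).readySimPreorder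
    (.app f ps qs fun i => .base (h i))
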